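/- Let $n\ge 3$ and $\nu=n/2-1$. Let $C_k^{\nu}$ be the Gegenbauer (ultraspherical) polynomial of degree $k$, in the standard normalization $$C_k^{\nu}(x)=\sum_{0\le j\le k/2}\frac{(-1)^j(\nu)_{k-j}}{j!\,(k-2j)!}(2x)^{k-2j},\qquad (\nu)_m=\nu(\nu+1)\cdots(\nu+m-1).$$ There is a constant $C>0$ depending only on $n$ such that, for every integer $k\ge 1$, every $\zeta\in S^{n-1}$ and all real $h_1,h_2$, the concentric spherical caps $\mathfrak a=\{\alpha\in S^{n-1}:\alpha\cdot\zeta\ge h_1\}$ and $\mathfrak b=\{\beta\in S^{n-1}:\beta\cdot\zeta\ge h_2\}$ satisfy $$\left|\int_{\mathfrak a}\int_{\mathfrak b} C_k^{\nu}(\alpha\cdot\beta)\,d\beta\,d\alpha\right|\le C\,k^{\,n/2-3},$$ where $d\alpha$ and $d\beta$ denote surface measure on $S^{n-1}\subset\mathbb R^n$. -/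

import Mathlib

open MeasureTheory

/-- The unit sphere `S^{n-1}` in Euclidean space `ℝⁿ`. -/
abbrev UnitSphere (n : ℕ) : Type :=
  Metric.sphere (0 : EuclideanSpace ℝ (Fin n)) 1

/-- The surface measure on `S^{n-1}` induced by Lebesgue measure on `ℝⁿ`
(not normalized: its total mass is `n` times the volume of the unit ball). -/
noncomputable def surfaceMeasure (n : ℕ) : Measure (UnitSphere n) :=
  (volume : Measure (EuclideanSpace ℝ (Fin n))).toSphere

/-- The dot product `α · β` of two points of the unit sphere. -/
noncomputable def sphereDot {n : ℕ} (α β : UnitSphere n) : ℝ :=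
  inner ℝ (α : EuclideanSpace ℝ (Fin n)) (β : EuclideanSpace ℝ (Fin n))

/-- The spherical cap `{α ∈ S^{n-1} : α · ζ ≥ h}` centred at `ζ`. It is the whole sphere for
`h ≤ -1`, and empty for `h > 1`; caps with the same `ζ` are concentric. -/
def sphericalCap {n : ℕ} (ζ : UnitSphere n) (h : ℝ) : Set (UnitSphere n) :=
  {α | h ≤ sphereDot α ζ}

/-- The Gegenbauer (ultraspherical) polynomial
`C_k^ν(x) = ∑_{0 ≤ j ≤ k/2} (-1)^j (ν)_{k-j} / (j! (k-2j)!) (2x)^{k-2j}`,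
where `(ν)_m = ν (ν+1) ⋯ (ν+m-1)` is the rising factorial. -/
noncomputable def gegenbauer (ν : ℝ) (k : ℕ) : Polynomial ℝ :=
  ∑ j ∈ Finset.range (k / 2 + 1),
    Polynomial.C ((-1) ^ j * (ascPochhammer ℝ (k - j)).eval ν /
      ((j.factorial : ℝ) * ((k - 2 * j).factorial : ℝ))) *
      (2 * Polynomial.X) ^ (k - 2 * j)

/-!
Write `P` for the Gegenbauer polynomial, `lam = k (k + n - 2)` and `N = n - 2`. With
`G(θ) = P(cos θ)`, the Gegenbauer equation is the zonal eigenvalue equation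
`G'' + N cot θ · G' + lam · G = 0`.

The integral of `P(α · β)` over `α` in a cap about `ζ` depends only on the polar angle of `β` about
`ζ`, by reflection symmetry, and it solves the same equation as `G`
(`exists_isZonalSolution_capIntegral`). A solution that is regular at the pole is determined by its
value there, so this integral equals `P(β · ζ) J / P(1)`, where `J` is its value at `β = ζ`
(`capIntegral_mul_eval_one`). Hence the double integral over two caps is `J₁ J₂ / P(1)`.

Both `J` and `P(1)` are compared with `F = P'(0)² + lam P(0)²`, the value on the equator
`θ = π / 2` of the energy `E = G'² + lam G²`.

* In polar coordinates, with `T` the angular radius of the cap, `J` is a constant times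
  `∫₀ᵀ G sin^N θ dθ = - sin^N T · G'(T) / lam`. The weighted energy `sin^{2N} θ · E` is largest on
  the equator, so `|J| ≤ c √F / lam` (`exists_capIntegral_center_sq_le`).
* The energy itself decreases from the pole to the equator, so `F ≤ E(0) = lam P(1)²`.

Together these bound the double integral by `c² √F / lam^{3/2}`, without the value of `P(1)`. The
explicit coefficients give `√F ≤ C √lam k^ν` (`equatorEnergy_le`), which leaves the bound
`C k^{ν-2}`, and `ν - 2 = n/2 - 3`.
-/

/-! ### Gegenbauer polynomials -/

lemma two_mul_X_pow (i : ℕ) : ((2 : Polynomial ℝ) * Polynomial.X) ^ i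
    = Polynomial.C ((2 : ℝ) ^ i) * Polynomial.X ^ i := by
  rw [mul_pow, Polynomial.C_pow]
  rfl

lemma gegenbauer_coeff_add_two_mul (ν : ℝ) (m j : ℕ) :
    (gegenbauer ν (m + 2 * j)).coeff m =
      (-1) ^ j * (ascPochhammer ℝ (m + j)).eval ν / ((j.factorial : ℝ) * (m.factorial : ℝ)) *
        2 ^ m := by
  rw [gegenbauer, Polynomial.finsetSum_coeff, Finset.sum_eq_single j]
  · rw [two_mul_X_pow, Polynomial.coeff_C_mul, Polynomial.coeff_C_mul_X_pow,
      show m + 2 * j - 2 * j = m by lia, show m + 2 * j - j = m + j by lia, if_pos rfl]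
  · intro i hi hij
    rw [Finset.mem_range] at hi
    rw [two_mul_X_pow, Polynomial.coeff_C_mul, Polynomial.coeff_C_mul_X_pow,
      if_neg (by lia), mul_zero]
  · intro h
    exact absurd (Finset.mem_range.2 (by lia)) h

lemma gegenbauer_coeff_eq_zero (ν : ℝ) (k m : ℕ) (h : ∀ j, k ≠ m + 2 * j) :
    (gegenbauer ν k).coeff m = 0 := by
  rw [gegenbauer, Polynomial.finsetSum_coeff]
  refine Finset.sum_eq_zero fun i hi => ?_
  rw [Finset.mem_range] at hi
  have := h i
  rw [two_mul_X_pow, Polynomial.coeff_C_mul, Polynomial.coeff_C_mul_X_pow,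
    if_neg (by lia), mul_zero]

/-- The Gegenbauer differential equation, read off coefficient by coefficient. -/
lemma gegenbauer_coeff_recurrence (ν : ℝ) (k m : ℕ) :
    ((m : ℝ) + 2) * (m + 1) * (gegenbauer ν k).coeff (m + 2) =
      -((k - m) * (k + m + 2 * ν)) * (gegenbauer ν k).coeff m := by
  by_cases h : ∃ j, k = m + 2 * j
  · obtain ⟨j, rfl⟩ := h
    rcases j with _ | i
    · rw [gegenbauer_coeff_eq_zero _ _ (m + 2) (by lia)]
      simp
    · rw [gegenbauer_coeff_add_two_mul, show m + 2 * (i + 1) = (m + 2) + 2 * i by ring,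
        gegenbauer_coeff_add_two_mul, show m + 2 + i = (m + (i + 1)) + 1 by ring,
        ascPochhammer_succ_eval]
      have h₁ : ((i.factorial : ℕ) : ℝ) ≠ 0 := by positivity
      have h₂ : ((m.factorial : ℕ) : ℝ) ≠ 0 := by positivity
      simp only [Nat.factorial_succ]
      push_cast
      field_simp
      ring
  · push Not at h
    rw [gegenbauer_coeff_eq_zero _ _ _ h, gegenbauer_coeff_eq_zero _ _ (m + 2), mul_zero, mul_zero]
    intro j hj
    exact h (j + 1) (by lia)

lemma gegenbauer_ode (ν : ℝ) (k : ℕ) (x : ℝ) :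
    (1 - x ^ 2) * (gegenbauer ν k).derivative.derivative.eval x
      - (2 * ν + 1) * x * (gegenbauer ν k).derivative.eval x
      + k * (k + 2 * ν) * (gegenbauer ν k).eval x = 0 := by
  have hrec := gegenbauer_coeff_recurrence ν k
  generalize gegenbauer ν k = P at hrec ⊢
  -- Opaque names for the constants keep `simp` from distributing `Polynomial.C` over them.
  obtain ⟨a, ha⟩ : ∃ a, a = 2 * ν + 1 := ⟨_, rfl⟩
  obtain ⟨c, hc⟩ : ∃ c, c = k * (k + 2 * ν) := ⟨_, rfl⟩
  have key : P.derivative.derivative - Polynomial.X * (Polynomial.X * P.derivative.derivative)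
      - Polynomial.C a * (Polynomial.X * P.derivative) + Polynomial.C c * P = 0 := by
    ext m
    specialize hrec m
    rcases m with _ | _ | m <;>
    · simp [Polynomial.coeff_derivative] at hrec ⊢
      subst ha hc
      linear_combination hrec
  have := congrArg (Polynomial.eval x) key
  simp at this
  rw [← ha, ← hc]
  linear_combination this

lemma gegenbauer_eval_neg (ν : ℝ) (k : ℕ) (x : ℝ) :
    (gegenbauer ν k).eval (-x) = (-1) ^ k * (gegenbauer ν k).eval x := by
  simp only [gegenbauer, Polynomial.eval_finsetSum, Finset.mul_sum]
  refine Finset.sum_congr rfl fun j hj => ?_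
  rw [Finset.mem_range] at hj
  obtain ⟨i, rfl⟩ : ∃ i, k = i + 2 * j := ⟨k - 2 * j, by lia⟩
  simp only [Polynomial.eval_mul, Polynomial.eval_C, Polynomial.eval_pow, Polynomial.eval_X,
    Polynomial.eval_ofNat, Nat.add_sub_cancel]
  rw [pow_add, pow_mul (-1 : ℝ) 2 j, mul_neg, neg_pow (2 * x)]
  norm_num
  ring

/-- `(ν)_m / m! ≤ (m + 1) ^ ν`, by induction on `m` from Bernoulli's inequality. -/
lemma ascPochhammer_eval_le {ν : ℝ} (hν : 0 ≤ ν) (m : ℕ) :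
    (ascPochhammer ℝ m).eval ν ≤ m.factorial * ((m : ℝ) + 1) ^ ν := by
  induction m with
  | zero => simp
  | succ m ih =>
    rw [ascPochhammer_succ_eval, Nat.factorial_succ]
    have hm : (0 : ℝ) < (m : ℝ) + 1 := by positivity
    have hpos : (0 : ℝ) < ((m : ℝ) + 1) ^ ν := Real.rpow_pos_of_pos hm ν
    have hstep : (ν + m) * ((m : ℝ) + 1) ^ ν ≤ (m + 1) * ((m : ℝ) + 1 + 1) ^ ν := by
      rcases le_total 1 ν with h1 | h1
      · have hb : 1 + ν * (1 / ((m : ℝ) + 1)) ≤ (1 + 1 / ((m : ℝ) + 1)) ^ ν :=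
          one_add_mul_self_le_rpow_one_add (le_trans (by norm_num) (by positivity :
            (0 : ℝ) ≤ 1 / ((m : ℝ) + 1))) h1
        have hsplit : ((m : ℝ) + 1 + 1) ^ ν
            = (1 + 1 / ((m : ℝ) + 1)) ^ ν * ((m : ℝ) + 1) ^ ν := by
          rw [← Real.mul_rpow (by positivity) hm.le]
          congr 1
          field_simp
        rw [hsplit, ← mul_assoc]
        refine mul_le_mul_of_nonneg_right ?_ hpos.le
        calc ν + m ≤ (m + 1) * (1 + ν * (1 / ((m : ℝ) + 1))) := by
              field_simp
              linarith
          _ ≤ _ := mul_le_mul_of_nonneg_left hb hm.le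
      · have : ((m : ℝ) + 1) ^ ν ≤ ((m : ℝ) + 1 + 1) ^ ν :=
          Real.rpow_le_rpow hm.le (by linarith) hν
        exact mul_le_mul (by linarith) this hpos.le hm.le
    have hf : (0 : ℝ) ≤ m.factorial := by positivity
    push_cast
    calc (ascPochhammer ℝ m).eval ν * (ν + m)
        ≤ (m.factorial * ((m : ℝ) + 1) ^ ν) * (ν + m) :=
          mul_le_mul_of_nonneg_right ih (by positivity)
      _ = m.factorial * ((ν + m) * ((m : ℝ) + 1) ^ ν) := by ring
      _ ≤ m.factorial * ((m + 1) * ((m : ℝ) + 1 + 1) ^ ν) := mul_le_mul_of_nonneg_left hstep hf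
      _ = _ := by ring

/-- The energy `P'² + k (k + 2ν) P²` of the equation at `x = 0`, that is, on the equator. -/
noncomputable def equatorEnergy (ν : ℝ) (k : ℕ) : ℝ :=
  (gegenbauer ν k).derivative.eval 0 ^ 2 + k * (k + 2 * ν) * (gegenbauer ν k).eval 0 ^ 2

lemma gegenbauer_eval_zero (ν : ℝ) (k : ℕ) :
    (gegenbauer ν k).eval 0 = (gegenbauer ν k).coeff 0 :=
  (Polynomial.coeff_zero_eq_eval_zero _).symm

lemma gegenbauer_derivative_eval_zero (ν : ℝ) (k : ℕ) :
    (gegenbauer ν k).derivative.eval 0 = (gegenbauer ν k).coeff 1 := by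
  rw [← Polynomial.coeff_zero_eq_eval_zero, Polynomial.coeff_derivative]
  simp

lemma equatorEnergy_pos {ν : ℝ} (hν : 0 < ν) {k : ℕ} (hk : 1 ≤ k) : 0 < equatorEnergy ν k := by
  have hk' : (0 : ℝ) < k := by exact_mod_cast hk
  have hp := fun m => ascPochhammer_pos m ν hν
  rw [equatorEnergy, gegenbauer_eval_zero, gegenbauer_derivative_eval_zero]
  rcases Nat.even_or_odd' k with ⟨j, h | h⟩
  · have h0 : (gegenbauer ν k).coeff 0 ≠ 0 := by
      rw [show k = 0 + 2 * j by lia, gegenbauer_coeff_add_two_mul]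
      have := (hp (0 + j)).ne'
      positivity
    positivity
  · have h0 : (gegenbauer ν k).coeff 1 ≠ 0 := by
      rw [show k = 1 + 2 * j by lia, gegenbauer_coeff_add_two_mul]
      have := (hp (1 + j)).ne'
      positivity
    positivity

/-- The energy on the equator is `O(k ^ (2ν + 2))`. This is all that the cap estimate needs; the
true order is `k ^ (2ν)`. -/
lemma equatorEnergy_le {ν : ℝ} (hν : 0 < ν) {k : ℕ} (hk : 1 ≤ k) :
    equatorEnergy ν k ≤ k * (k + 2 * ν) * (2 * (ν + 1) * (k : ℝ) ^ ν) ^ 2 := by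
  have hk' : (1 : ℝ) ≤ k := by exact_mod_cast hk
  have hkν : (0 : ℝ) < (k : ℝ) ^ ν := Real.rpow_pos_of_pos (by linarith) ν
  rw [equatorEnergy, gegenbauer_eval_zero, gegenbauer_derivative_eval_zero]
  -- Up to sign, one of `P 0`, `P' 0` is `0`, and the other is `(ν)_j / j!`, respectively
  -- `2 (ν + j) (ν)_j / j!`, where `j = ⌊k / 2⌋`.
  have ha : ∀ j : ℕ, j + 1 ≤ k →
      (ascPochhammer ℝ j).eval ν / (j.factorial : ℝ) ≤ (k : ℝ) ^ ν := by
    intro j hj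
    rw [div_le_iff₀ (by positivity), mul_comm]
    refine (ascPochhammer_eval_le hν.le j).trans (mul_le_mul_of_nonneg_left ?_ (by positivity))
    exact Real.rpow_le_rpow (by positivity) (by exact_mod_cast hj) hν.le
  have ha0 : ∀ j : ℕ, 0 ≤ (ascPochhammer ℝ j).eval ν / (j.factorial : ℝ) :=
    fun j => div_nonneg (ascPochhammer_pos j ν hν).le (by positivity)
  rcases Nat.even_or_odd' k with ⟨j, h | h⟩
  · rw [gegenbauer_coeff_eq_zero ν k 1 (by lia)]
    have h0 : (gegenbauer ν k).coeff 0
        = (-1) ^ j * ((ascPochhammer ℝ j).eval ν / (j.factorial : ℝ)) := by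
      rw [show k = 0 + 2 * j by lia, gegenbauer_coeff_add_two_mul]
      simp
      ring
    have h1 := ha j (by lia)
    have h2 := ha0 j
    have h3 : (gegenbauer ν k).coeff 0 ^ 2 ≤ (2 * (ν + 1) * (k : ℝ) ^ ν) ^ 2 := by
      rw [h0, mul_pow, ← pow_mul, mul_comm j 2, pow_mul]
      norm_num
      gcongr
      nlinarith
    have := mul_le_mul_of_nonneg_left h3 (by positivity : (0 : ℝ) ≤ k * (k + 2 * ν))
    linarith
  · rw [gegenbauer_coeff_eq_zero ν k 0 (by lia)]
    have h0 : (gegenbauer ν k).coeff 1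
        = (-1) ^ j * (2 * (ν + j) * ((ascPochhammer ℝ j).eval ν / (j.factorial : ℝ))) := by
      rw [show k = 1 + 2 * j by lia, gegenbauer_coeff_add_two_mul, add_comm 1 j,
        ascPochhammer_succ_eval]
      simp
      ring
    have h1 := ha j (by lia)
    have h2 := ha0 j
    have hj : ν + j ≤ (ν + 1) * k := by
      have : (j : ℝ) ≤ k := by exact_mod_cast (by lia : j ≤ k)
      nlinarith
    have h3 : (gegenbauer ν k).coeff 1 ^ 2 ≤ (k * (2 * (ν + 1) * (k : ℝ) ^ ν)) ^ 2 := by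
      rw [h0, mul_pow, ← pow_mul, mul_comm j 2, pow_mul]
      norm_num
      rw [show (k : ℝ) * (2 * (ν + 1) * (k : ℝ) ^ ν) = 2 * ((ν + 1) * k) * (k : ℝ) ^ ν by ring]
      gcongr
    have h4 : (k * (2 * (ν + 1) * (k : ℝ) ^ ν)) ^ 2
        ≤ k * (k + 2 * ν) * (2 * (ν + 1) * (k : ℝ) ^ ν) ^ 2 := by
      rw [mul_pow]
      gcongr
      nlinarith
    linarith

/-! ### The zonal equation in the polar angle -/

/-- `G₁` and `G₂` are the first two derivatives of `G₀`, which solves the zonal eigenvalue equation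
`G'' + N cot θ · G' + lam · G = 0` of the sphere `S^{N+1}` for `0 < θ < π`, where `θ` is the polar
angle. The equation is multiplied by `sin θ`. -/
structure IsZonalSolution (N : ℕ) (lam : ℝ) (G₀ G₁ G₂ : ℝ → ℝ) : Prop where
  hasDerivAt₀ : ∀ θ, HasDerivAt G₀ (G₁ θ) θ
  hasDerivAt₁ : ∀ θ, HasDerivAt G₁ (G₂ θ) θ
  ode : ∀ θ ∈ Set.Ioo 0 Real.pi,
    Real.sin θ * G₂ θ + N * Real.cos θ * G₁ θ + lam * Real.sin θ * G₀ θ = 0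

namespace IsZonalSolution

variable {N : ℕ} {lam : ℝ} {G₀ G₁ G₂ H₀ H₁ H₂ : ℝ → ℝ}

lemma lincomb (hG : IsZonalSolution N lam G₀ G₁ G₂) (hH : IsZonalSolution N lam H₀ H₁ H₂)
    (a b : ℝ) : IsZonalSolution N lam (fun θ => a * G₀ θ + b * H₀ θ)
      (fun θ => a * G₁ θ + b * H₁ θ) (fun θ => a * G₂ θ + b * H₂ θ) where
  hasDerivAt₀ θ := ((hG.hasDerivAt₀ θ).const_mul a).add ((hH.hasDerivAt₀ θ).const_mul b)
  hasDerivAt₁ θ := ((hG.hasDerivAt₁ θ).const_mul a).add ((hH.hasDerivAt₁ θ).const_mul b)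
  ode θ hθ := by linear_combination a * hG.ode θ hθ + b * hH.ode θ hθ

lemma hasDerivAt_energy (hG : IsZonalSolution N lam G₀ G₁ G₂) (θ : ℝ) :
    HasDerivAt (fun θ => G₁ θ ^ 2 + lam * G₀ θ ^ 2) (2 * G₁ θ * (G₂ θ + lam * G₀ θ)) θ := by
  convert! ((hG.hasDerivAt₁ θ).pow 2).add (((hG.hasDerivAt₀ θ).pow 2).const_mul lam) using 1
  simp
  ring

/-- The energy `G'² + lam G²` decreases on the northern hemisphere. -/
lemma energy_antitoneOn (hG : IsZonalSolution N lam G₀ G₁ G₂) :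
    AntitoneOn (fun θ => G₁ θ ^ 2 + lam * G₀ θ ^ 2) (Set.Icc 0 (Real.pi / 2)) := by
  refine antitoneOn_of_hasDerivWithinAt_nonpos (convex_Icc _ _)
    (fun θ _ => (hG.hasDerivAt_energy θ).continuousAt.continuousWithinAt)
    (fun θ _ => (hG.hasDerivAt_energy θ).hasDerivWithinAt) fun θ hθ => ?_
  rw [interior_Icc] at hθ
  have hπ := Real.pi_pos
  have hs : 0 < Real.sin θ := Real.sin_pos_of_pos_of_lt_pi hθ.1 (by linarith [hθ.2])
  have hc : 0 ≤ Real.cos θ := Real.cos_nonneg_of_mem_Icc ⟨by linarith [hθ.1], hθ.2.le⟩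
  have h := hG.ode θ ⟨hθ.1, by linarith [hθ.2]⟩
  have h0 : Real.sin θ * (2 * G₁ θ * (G₂ θ + lam * G₀ θ)) = -(2 * N * Real.cos θ * G₁ θ ^ 2) := by
    linear_combination 2 * G₁ θ * h
  have h1 : 0 ≤ 2 * N * Real.cos θ * G₁ θ ^ 2 := by positivity
  by_contra hneg
  push Not at hneg
  have := mul_pos hs hneg
  linarith

lemma hasDerivAt_weightedEnergy (hG : IsZonalSolution N lam G₀ G₁ G₂) (hN : N ≠ 0) {θ : ℝ}
    (hθ : θ ∈ Set.Ioo 0 Real.pi) :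
    HasDerivAt (fun θ => Real.sin θ ^ (2 * N) * (G₁ θ ^ 2 + lam * G₀ θ ^ 2))
      (2 * N * lam * Real.sin θ ^ (2 * N - 1) * Real.cos θ * G₀ θ ^ 2) θ := by
  convert! ((Real.hasDerivAt_sin θ).pow (2 * N)).mul (hG.hasDerivAt_energy θ) using 1
  have hpow : Real.sin θ ^ (2 * N) = Real.sin θ ^ (2 * N - 1) * Real.sin θ := by
    rw [← pow_succ]
    congr 1
    lia
  rw [Pi.pow_apply, hpow]
  push_cast
  linear_combination (-(2 * G₁ θ * Real.sin θ ^ (2 * N - 1))) * hG.ode θ hθ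

/-- The weighted energy `sin^{2N} θ (G'² + lam G²)` is largest on the equator. -/
lemma weightedEnergy_le (hG : IsZonalSolution N lam G₀ G₁ G₂) (hN : N ≠ 0) (hlam : 0 ≤ lam) {θ : ℝ}
    (hθ : θ ∈ Set.Icc 0 Real.pi) :
    Real.sin θ ^ (2 * N) * (G₁ θ ^ 2 + lam * G₀ θ ^ 2) ≤
      G₁ (Real.pi / 2) ^ 2 + lam * G₀ (Real.pi / 2) ^ 2 := by
  have hπ := Real.pi_pos
  have hcont : Continuous (fun θ => Real.sin θ ^ (2 * N) * (G₁ θ ^ 2 + lam * G₀ θ ^ 2)) := by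
    have h0 : Continuous G₀ :=
      continuous_iff_continuousAt.2 fun θ => (hG.hasDerivAt₀ θ).continuousAt
    have h1 : Continuous G₁ :=
      continuous_iff_continuousAt.2 fun θ => (hG.hasDerivAt₁ θ).continuousAt
    fun_prop
  have hsign : ∀ t ∈ Set.Ioo 0 Real.pi, 0 ≤ 2 * N * lam * Real.sin t ^ (2 * N - 1) * G₀ t ^ 2 := by
    intro t ht
    have := Real.sin_pos_of_pos_of_lt_pi ht.1 ht.2
    positivity
  have hend : G₁ (Real.pi / 2) ^ 2 + lam * G₀ (Real.pi / 2) ^ 2 = Real.sin (Real.pi / 2) ^ (2 * N) *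
      (G₁ (Real.pi / 2) ^ 2 + lam * G₀ (Real.pi / 2) ^ 2) := by simp
  rw [hend]
  rcases le_total θ (Real.pi / 2) with h | h
  · refine monotoneOn_of_hasDerivWithinAt_nonneg (D := Set.Icc 0 (Real.pi / 2))
      (f' := fun t => 2 * N * lam * Real.sin t ^ (2 * N - 1) * Real.cos t * G₀ t ^ 2)
      (convex_Icc _ _) hcont.continuousOn (fun t ht => ?_) (fun t ht => ?_)
      ⟨hθ.1, h⟩ ⟨by positivity, le_rfl⟩ h
    all_goals rw [interior_Icc] at ht
    · exact (hG.hasDerivAt_weightedEnergy hN ⟨ht.1, by linarith [ht.2]⟩).hasDerivWithinAt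
    · have h1 := hsign t ⟨ht.1, by linarith [ht.2]⟩
      have h2 : 0 ≤ Real.cos t := Real.cos_nonneg_of_mem_Icc ⟨by linarith [ht.1], ht.2.le⟩
      nlinarith
  · refine antitoneOn_of_hasDerivWithinAt_nonpos (D := Set.Icc (Real.pi / 2) Real.pi)
      (f' := fun t => 2 * N * lam * Real.sin t ^ (2 * N - 1) * Real.cos t * G₀ t ^ 2)
      (convex_Icc _ _) hcont.continuousOn (fun t ht => ?_) (fun t ht => ?_)
      ⟨le_rfl, by linarith⟩ ⟨h, hθ.2⟩ h
    all_goals rw [interior_Icc] at ht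
    · exact (hG.hasDerivAt_weightedEnergy hN ⟨by linarith [ht.1], ht.2⟩).hasDerivWithinAt
    · have h1 := hsign t ⟨by linarith [ht.1], ht.2⟩
      have h2 : Real.cos t ≤ 0 :=
        Real.cos_nonpos_of_pi_div_two_le_of_le ht.1.le (by linarith [ht.2])
      nlinarith

/-- A solution that vanishes to first order at the north pole vanishes on the northern
hemisphere, as its energy decreases from `0`. -/
lemma eq_zero (hG : IsZonalSolution N lam G₀ G₁ G₂) (hlam : 0 < lam) (h0 : G₀ 0 = 0)
    (h1 : G₁ 0 = 0) {θ : ℝ} (hθ : θ ∈ Set.Icc 0 (Real.pi / 2)) : G₀ θ = 0 := by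
  have h := hG.energy_antitoneOn ⟨le_rfl, hθ.1.trans hθ.2⟩ hθ hθ.1
  simp only [h0, h1] at h
  have h2 : lam * G₀ θ ^ 2 ≤ 0 := by nlinarith [sq_nonneg (G₁ θ)]
  have h3 : G₀ θ ^ 2 ≤ 0 := by
    by_contra hneg
    push Not at hneg
    have := mul_pos hlam hneg
    linarith
  exact pow_eq_zero_iff two_ne_zero |>.1 (le_antisymm h3 (sq_nonneg _))

/-- The equation in divergence form: `(sin^N θ · G')' = - lam sin^N θ · G`. -/
lemma integral_mul_sin_pow (hG : IsZonalSolution N lam G₀ G₁ G₂) (hN : N ≠ 0) {T : ℝ}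
    (hT : T ∈ Set.Icc 0 Real.pi) :
    lam * ∫ θ in (0)..T, G₀ θ * Real.sin θ ^ N = -(Real.sin T ^ N * G₁ T) := by
  have h0 : Continuous G₀ :=
    continuous_iff_continuousAt.2 fun θ => (hG.hasDerivAt₀ θ).continuousAt
  have h1 : Continuous G₁ :=
    continuous_iff_continuousAt.2 fun θ => (hG.hasDerivAt₁ θ).continuousAt
  have h := intervalIntegral.integral_eq_sub_of_hasDerivAt_of_le hT.1
    (f := fun θ => -(Real.sin θ ^ N * G₁ θ)) (f' := fun θ => lam * (G₀ θ * Real.sin θ ^ N))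
    (by fun_prop) (fun θ hθ => ?_) (Continuous.intervalIntegrable (by fun_prop) _ _)
  · rw [intervalIntegral.integral_const_mul] at h
    rw [h]
    simp [hN]
  · convert! (((Real.hasDerivAt_sin θ).pow N).mul (hG.hasDerivAt₁ θ)).neg using 1
    have hpow : Real.sin θ ^ N = Real.sin θ ^ (N - 1) * Real.sin θ := by
      rw [← pow_succ]
      congr 1
      lia
    rw [Pi.pow_apply, hpow]
    linear_combination Real.sin θ ^ (N - 1) * hG.ode θ ⟨hθ.1, hθ.2.trans_le hT.2⟩

end IsZonalSolution

lemma isZonalSolution_polynomial {N : ℕ} {lam : ℝ} {P : Polynomial ℝ}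
    (hP : ∀ x, (1 - x ^ 2) * P.derivative.derivative.eval x
      - (N + 1) * x * P.derivative.eval x + lam * P.eval x = 0) :
    IsZonalSolution N lam (fun θ => P.eval (Real.cos θ))
      (fun θ => -(Real.sin θ * P.derivative.eval (Real.cos θ)))
      (fun θ => Real.sin θ ^ 2 * P.derivative.derivative.eval (Real.cos θ)
        - Real.cos θ * P.derivative.eval (Real.cos θ)) where
  hasDerivAt₀ θ := by
    convert! (P.hasDerivAt (Real.cos θ)).comp θ (Real.hasDerivAt_cos θ) using 1
    ring
  hasDerivAt₁ θ := by
    convert! ((Real.hasDerivAt_sin θ).mul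
      ((P.derivative.hasDerivAt (Real.cos θ)).comp θ (Real.hasDerivAt_cos θ))).neg using 1
    ring_nf
    simp only [Function.comp]
  ode θ _ := by
    have := Real.sin_sq_add_cos_sq θ
    have h := hP (Real.cos θ)
    linear_combination Real.sin θ * h
      + Real.sin θ * P.derivative.derivative.eval (Real.cos θ) * this

/-! ### The surface measure in polar coordinates -/

/-- If `F(r α) = f(α) g(r)` for `α` on the sphere and `r > 0`, then the integral of `F` over `ℝⁿ`
splits. -/
lemma integral_sphere_mul_radial {n : ℕ} (hn : n ≠ 0) (f : UnitSphere n → ℝ) (g : ℝ → ℝ)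
    (F : EuclideanSpace ℝ (Fin n) → ℝ)
    (hF : ∀ (α : UnitSphere n) (r : ℝ), 0 < r →
      F (r • (α : EuclideanSpace ℝ (Fin n))) = f α * g r) :
    ∫ x, F x = (∫ α, f α ∂surfaceMeasure n) * ∫ r in Set.Ioi (0 : ℝ), r ^ (n - 1) * g r := by
  have : Nonempty (Fin n) := ⟨⟨0, by lia⟩⟩
  have : Nontrivial (EuclideanSpace ℝ (Fin n)) := inferInstance
  calc
    ∫ x, F x = ∫ x : ({(0)}ᶜ : Set (EuclideanSpace ℝ (Fin n))), F x.1
        ∂((volume : Measure (EuclideanSpace ℝ (Fin n))).comap (↑)) := by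
      rw [integral_subtype_comap (measurableSet_singleton _).compl F,
        restrict_compl_singleton]
    _ = ∫ p, f p.1 * g p.2 ∂((volume : Measure (EuclideanSpace ℝ (Fin n))).toSphere.prod
          (.volumeIoiPow (Module.finrank ℝ (EuclideanSpace ℝ (Fin n)) - 1))) := by
      rw [← ((volume : Measure
        (EuclideanSpace ℝ (Fin n))).measurePreserving_homeomorphUnitSphereProd).integral_comp
        (Homeomorph.measurableEmbedding _)]
      congr 1
      ext x
      have hx : (0 : ℝ) < ‖x.1‖ := norm_pos_iff.2 x.2
      rw [← hF _ _ (homeomorphUnitSphereProd _ x).2.2]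
      simp [smul_smul, hx.ne']
    _ = (∫ α, f α ∂surfaceMeasure n) * ∫ r : Set.Ioi (0 : ℝ), g r
          ∂(.volumeIoiPow (Module.finrank ℝ (EuclideanSpace ℝ (Fin n)) - 1)) :=
      integral_prod_mul f (fun r : Set.Ioi (0 : ℝ) => g r)
    _ = _ := by
      congr 1
      simp only [Measure.volumeIoiPow, ENNReal.ofReal]
      rw [integral_withDensity_eq_integral_smul,
        integral_subtype_comap measurableSet_Ioi fun a ↦ Real.toNNReal
          (a ^ (Module.finrank ℝ (EuclideanSpace ℝ (Fin n)) - 1)) • g a,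
        setIntegral_congr_fun measurableSet_Ioi fun x hx ↦ ?_]
      · rw [NNReal.smul_def, Real.coe_toNNReal _ (pow_nonneg hx.out.le _)]
        simp
      · exact (measurable_subtype_coe.pow_const _).real_toNNReal

/-- An isometry of `ℝⁿ` acting on the unit sphere. -/
noncomputable def sphereMap {n : ℕ}
    (T : EuclideanSpace ℝ (Fin n) ≃ₗᵢ[ℝ] EuclideanSpace ℝ (Fin n)) :
    UnitSphere n ≃ᵐ UnitSphere n where
  toFun α := ⟨T α, by simp⟩
  invFun α := ⟨T.symm α, by simp⟩
  left_inv α := by simp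
  right_inv α := by simp
  measurable_toFun := (T.continuous.measurable.comp measurable_subtype_coe).subtype_mk
  measurable_invFun := (T.symm.continuous.measurable.comp measurable_subtype_coe).subtype_mk

@[simp] lemma coe_sphereMap {n : ℕ}
    (T : EuclideanSpace ℝ (Fin n) ≃ₗᵢ[ℝ] EuclideanSpace ℝ (Fin n)) (α : UnitSphere n) :
    (sphereMap T α : EuclideanSpace ℝ (Fin n)) = T α := rfl

lemma measurePreserving_sphereMap {n : ℕ}
    (T : EuclideanSpace ℝ (Fin n) ≃ₗᵢ[ℝ] EuclideanSpace ℝ (Fin n)) :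
    MeasurePreserving (sphereMap T) (surfaceMeasure n) (surfaceMeasure n) := by
  refine ⟨(sphereMap T).measurable, ?_⟩
  ext s hs
  rw [Measure.map_apply (sphereMap T).measurable hs, surfaceMeasure,
    Measure.toSphere_apply' _ ((sphereMap T).measurable hs), Measure.toSphere_apply' _ hs]
  congr 1
  refine Eq.trans ?_ (MeasurePreserving.measure_preimage_equiv (f := T.toMeasurableEquiv)
    T.measurePreserving _)
  congr 1
  ext x
  constructor
  · rintro ⟨r, hr, _, ⟨α, hα, rfl⟩, rfl⟩
    exact ⟨r, hr, _, ⟨_, hα, rfl⟩, by simp⟩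
  · rintro ⟨r, hr, _, ⟨α, hα, rfl⟩, h⟩
    refine ⟨r, hr, T.symm α, ⟨(sphereMap T).symm α, by simpa using hα, rfl⟩, ?_⟩
    apply T.injective
    simpa using h


/-- `ℝ^{n+1}` as the product of the first coordinate axis and `ℝⁿ`. -/
noncomputable def splitFirst (n : ℕ) :
    EuclideanSpace ℝ (Fin (n + 1)) ≃ᵐ ℝ × EuclideanSpace ℝ (Fin n) :=
  ((MeasurableEquiv.toLp 2 (Fin (n + 1) → ℝ)).symm.trans
    (MeasurableEquiv.piFinSuccAbove (fun _ => ℝ) 0)).trans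
    ((MeasurableEquiv.refl ℝ).prodCongr (MeasurableEquiv.toLp 2 (Fin n → ℝ)))

lemma measurePreserving_splitFirst (n : ℕ) : MeasurePreserving (splitFirst n) :=
  ((MeasurePreserving.id volume).prod (PiLp.volume_preserving_toLp (Fin n))).comp
    ((volume_preserving_piFinSuccAbove (fun _ : Fin (n + 1) => ℝ) 0).comp
      (PiLp.volume_preserving_ofLp (Fin (n + 1))))

@[simp] lemma splitFirst_fst {n : ℕ} (x : EuclideanSpace ℝ (Fin (n + 1))) :
    (splitFirst n x).1 = x 0 := rfl

lemma splitFirst_norm_sq {n : ℕ} (x : EuclideanSpace ℝ (Fin (n + 1))) :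
    (splitFirst n x).1 ^ 2 + ‖(splitFirst n x).2‖ ^ 2 = ‖x‖ ^ 2 := by
  rw [EuclideanSpace.norm_sq_eq, EuclideanSpace.norm_sq_eq, Fin.sum_univ_succ]
  simp only [Real.norm_eq_abs, sq_abs]
  rfl

/-- Cylindrical coordinates about the first axis, followed by polar coordinates in the half-plane of
pairs `(t, r)` with `r > 0`. `H` is extended by zero to the other half-plane, as `polarCoord`
parametrizes the whole plane. -/
lemma integral_first_coord_norm {n : ℕ} (hn : n ≠ 0) (H : ℝ → ℝ → ℝ)
    (hH : Measurable (Function.uncurry H))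
    (hb : ∃ M, ∀ t r, |H t r| ≤ M) (hs : ∀ t r, 1 < t ^ 2 + r ^ 2 → H t r = 0) :
    ∫ x : EuclideanSpace ℝ (Fin (n + 1)), H (splitFirst n x).1 ‖(splitFirst n x).2‖ =
      n * volume.real (Metric.ball (0 : EuclideanSpace ℝ (Fin n)) 1) *
        ∫ p in polarCoord.target, p.1 * (if 0 < p.1 * Real.sin p.2 then
          (p.1 * Real.sin p.2) ^ (n - 1) * H (p.1 * Real.cos p.2) (p.1 * Real.sin p.2) else 0) := by
  obtain ⟨M, hM⟩ := hb
  have hM0 : 0 ≤ M := (abs_nonneg _).trans (hM 0 0)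
  have : Nonempty (Fin n) := ⟨⟨0, by lia⟩⟩
  have hint : Integrable (fun q : ℝ × EuclideanSpace ℝ (Fin n) => H q.1 ‖q.2‖) := by
    have hm : Measurable (fun q : ℝ × EuclideanSpace ℝ (Fin n) => H q.1 ‖q.2‖) :=
      hH.comp (measurable_fst.prodMk measurable_snd.norm)
    refine IntegrableOn.integrable_of_forall_notMem_eq_zero
      (s := Metric.closedBall 0 1) (Measure.integrableOn_of_bounded (M := M)
        (isCompact_closedBall _ _).measure_lt_top.ne hm.aestronglyMeasurable
        (Filter.Eventually.of_forall fun q => hM _ _)) fun q hq => hs _ _ ?_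
    rw [Metric.mem_closedBall, dist_zero_right, Prod.norm_def, max_le_iff, not_and_or] at hq
    rcases hq with h | h
    · rw [Real.norm_eq_abs, not_le] at h
      nlinarith [sq_abs q.1, sq_nonneg ‖q.2‖]
    · nlinarith [sq_nonneg q.1]
  set K : ℝ × ℝ → ℝ := fun q => if 0 < q.2 then q.2 ^ (n - 1) * H q.1 q.2 else 0 with hK
  have hKint : Integrable K := by
    have hm : Measurable K := Measurable.ite (measurableSet_lt measurable_const measurable_snd)
      ((measurable_snd.pow_const _).mul hH) measurable_const
    refine IntegrableOn.integrable_of_forall_notMem_eq_zero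
      (s := Metric.closedBall 0 1) (Measure.integrableOn_of_bounded (M := M)
        (isCompact_closedBall _ _).measure_lt_top.ne hm.aestronglyMeasurable ?_) fun q hq => ?_
    · refine (ae_restrict_iff' measurableSet_closedBall).2
        (Filter.Eventually.of_forall fun q hq => ?_)
      rw [Metric.mem_closedBall, dist_zero_right, Prod.norm_def, max_le_iff] at hq
      simp only [hK]
      split_ifs with h
      · rw [norm_mul, norm_pow]
        exact (mul_le_of_le_one_left (norm_nonneg _) (pow_le_one₀ (norm_nonneg _) hq.2)).trans
          (hM _ _)
      · simpa using hM0
    · rw [Metric.mem_closedBall, dist_zero_right, Prod.norm_def, max_le_iff, not_and_or,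
        Real.norm_eq_abs, Real.norm_eq_abs, not_le, not_le] at hq
      have : H q.1 q.2 = 0 := hs _ _ (by
        rcases hq with h | h
        · nlinarith [sq_abs q.1, sq_nonneg q.2]
        · nlinarith [sq_abs q.2, sq_nonneg q.1])
      simp [hK, this]
  calc
    _ = ∫ q : ℝ × EuclideanSpace ℝ (Fin n), H q.1 ‖q.2‖ :=
      (measurePreserving_splitFirst n).integral_comp' (fun q => H q.1 ‖q.2‖)
    _ = ∫ t, ∫ y : EuclideanSpace ℝ (Fin n), H t ‖y‖ := integral_prod _ hint
    _ = ∫ t, (n * volume.real (Metric.ball (0 : EuclideanSpace ℝ (Fin n)) 1)) * ∫ r, K (t, r) := by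
      congr 1
      ext t
      rw [integral_fun_norm_addHaar, ← integral_indicator measurableSet_Ioi]
      simp [mul_assoc, hK, Set.indicator_apply]
    _ = (n * volume.real (Metric.ball (0 : EuclideanSpace ℝ (Fin n)) 1)) * ∫ q, K q := by
      rw [integral_const_mul, Measure.volume_eq_prod, integral_prod _ hKint]
    _ = _ := by
      rw [← integral_comp_polarCoord_symm]
      rfl

/-- The first coordinate of a point of `Sⁿ`, written as `cos θ`, has density `sin^{n-1} θ` up to a
constant: compare the integral of `φ(x₀ / ‖x‖)` over the unit ball of `ℝ^{n+1}` in spherical and in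
cylindrical coordinates. -/
lemma integral_sphere_first_coord {n : ℕ} (hn : n ≠ 0) : ∃ c : ℝ, ∀ φ : ℝ → ℝ, Measurable φ →
    (∃ M, ∀ t, |φ t| ≤ M) →
    ∫ α : UnitSphere (n + 1), φ ((α : EuclideanSpace ℝ (Fin (n + 1))) 0)
        ∂surfaceMeasure (n + 1) =
      c * ∫ θ in (0)..Real.pi, φ (Real.cos θ) * Real.sin θ ^ (n - 1) := by
  refine ⟨n * volume.real (Metric.ball (0 : EuclideanSpace ℝ (Fin n)) 1), fun φ hφ hb => ?_⟩
  obtain ⟨M, hM⟩ := hb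
  -- the radial cutoff to the unit ball
  set g : ℝ → ℝ := fun r => if r ≤ 1 then 1 else 0 with hg
  set H : ℝ → ℝ → ℝ := fun t r => φ (t / √(t ^ 2 + r ^ 2)) * g (√(t ^ 2 + r ^ 2)) with hH
  have hgm : Measurable g := Measurable.ite measurableSet_Iic measurable_const measurable_const
  have h1 := integral_sphere_mul_radial (n := n + 1) (by lia) (fun α => φ (α.1 0)) g
    (fun x => H (splitFirst n x).1 ‖(splitFirst n x).2‖) (fun α r hr => by
      have hα : ‖α.1‖ = 1 := by simp
      simp only [hH, splitFirst_norm_sq]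
      rw [norm_smul, hα, Real.norm_eq_abs, abs_of_pos hr, mul_one, Real.sqrt_sq hr.le]
      simp [hr.ne'])
  have h2 := integral_first_coord_norm hn H (by
      have hs : Measurable fun p : ℝ × ℝ => √(p.1 ^ 2 + p.2 ^ 2) := by fun_prop
      exact (hφ.comp (measurable_fst.div hs)).mul (hgm.comp hs))
    ⟨M, fun t r => by
      simp only [hH, hg, abs_mul]
      have := hM (t / √(t ^ 2 + r ^ 2))
      split_ifs
      · rwa [abs_one, mul_one]
      · simp only [abs_zero, mul_zero]
        exact (abs_nonneg _).trans this⟩ (fun t r h => by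
      have : ¬ √(t ^ 2 + r ^ 2) ≤ 1 := by
        rw [not_le, Real.lt_sqrt (by norm_num)]
        linarith
      simp only [hH, hg, if_neg this, mul_zero])
  have hg1 : ∫ r in Set.Ioi (0 : ℝ), r ^ n * g r = 1 / (n + 1) := by
    have : ∀ r, r ^ n * g r = (Set.Iic 1).indicator (fun r : ℝ => r ^ n) r := by
      intro r
      simp [hg, Set.indicator_apply]
    simp_rw [this]
    rw [setIntegral_indicator measurableSet_Iic, Set.Ioi_inter_Iic,
      ← intervalIntegral.integral_of_le zero_le_one, integral_pow]
    simp
  have h3 : ∫ p in polarCoord.target, p.1 * (if 0 < p.1 * Real.sin p.2 then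
          (p.1 * Real.sin p.2) ^ (n - 1) * H (p.1 * Real.cos p.2) (p.1 * Real.sin p.2) else 0)
      = (∫ r in Set.Ioi (0 : ℝ), r ^ n * g r) *
        ∫ θ in (0)..Real.pi, φ (Real.cos θ) * Real.sin θ ^ (n - 1) := by
    have hθ : ∫ θ in (0)..Real.pi, φ (Real.cos θ) * Real.sin θ ^ (n - 1)
        = ∫ θ in Set.Ioo (-Real.pi) Real.pi,
          if 0 < Real.sin θ then φ (Real.cos θ) * Real.sin θ ^ (n - 1) else 0 := by
      have : ∀ θ ∈ Set.Ioo (-Real.pi) Real.pi,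
          (if 0 < Real.sin θ then φ (Real.cos θ) * Real.sin θ ^ (n - 1) else 0)
          = (Set.Ioi 0).indicator (fun θ => φ (Real.cos θ) * Real.sin θ ^ (n - 1)) θ := by
        intro θ hθ
        rcases lt_or_ge 0 θ with h | h
        · simp [h, Real.sin_pos_of_pos_of_lt_pi h hθ.2]
        · have := Real.sin_nonpos_of_nonpos_of_neg_pi_le h hθ.1.le
          simp [not_lt.2 this, not_lt.2 h]
      rw [setIntegral_congr_fun measurableSet_Ioo this, setIntegral_indicator measurableSet_Ioi,
        intervalIntegral.integral_of_le Real.pi_pos.le, integral_Ioc_eq_integral_Ioo]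
      congr 2
      ext θ
      simp only [Set.mem_Ioo, Set.mem_inter_iff, Set.mem_Ioi]
      have := Real.pi_pos
      constructor
      · rintro ⟨a, b⟩
        exact ⟨⟨by linarith, b⟩, a⟩
      · rintro ⟨⟨a, b⟩, c⟩
        exact ⟨c, b⟩
    rw [hθ, ← setIntegral_prod_mul, ← Measure.volume_eq_prod]
    refine setIntegral_congr_fun polarCoord.open_target.measurableSet fun p hp => ?_
    have hp1 : 0 < p.1 := hp.1
    have hn' : p.1 ^ n = p.1 * p.1 ^ (n - 1) := by
      rw [← pow_succ']
      congr 1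
      lia
    have hsq : (p.1 * Real.cos p.2) ^ 2 + (p.1 * Real.sin p.2) ^ 2 = p.1 ^ 2 := by
      linear_combination p.1 ^ 2 * Real.sin_sq_add_cos_sq p.2
    simp only [mul_pos_iff_of_pos_left hp1, hH, hsq, Real.sqrt_sq hp1.le, hn']
    rw [mul_div_cancel_left₀ _ hp1.ne']
    split_ifs
    · ring
    · simp
  rw [h2, h3, Nat.add_sub_cancel, hg1] at h1
  have hn1 : (n : ℝ) + 1 ≠ 0 := by positivity
  field_simp at h1
  exact h1.symm

lemma sphereDot_sphereMap {n : ℕ}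
    (T : EuclideanSpace ℝ (Fin n) ≃ₗᵢ[ℝ] EuclideanSpace ℝ (Fin n)) (α β : UnitSphere n) :
    sphereDot (sphereMap T α) (sphereMap T β) = sphereDot α β :=
  T.inner_map_map _ _

lemma integral_sphere_zonal {n : ℕ} (hn : n ≠ 0) :
    ∃ c : ℝ, ∀ (ζ : UnitSphere (n + 1)) (φ : ℝ → ℝ), Measurable φ → (∃ M, ∀ t, |φ t| ≤ M) →
    ∫ α, φ (sphereDot α ζ) ∂surfaceMeasure (n + 1) =
      c * ∫ θ in (0)..Real.pi, φ (Real.cos θ) * Real.sin θ ^ (n - 1) := by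
  obtain ⟨c, hc⟩ := integral_sphere_first_coord hn
  refine ⟨c, fun ζ φ hφ hb => ?_⟩
  rw [← hc φ hφ hb]
  have hζ : ‖(ζ : EuclideanSpace ℝ (Fin (n + 1)))‖ = 1 := by simp
  let e : EuclideanSpace ℝ (Fin (n + 1)) := EuclideanSpace.single 0 1
  let T := Submodule.reflection (ℝ ∙ ((ζ : EuclideanSpace ℝ (Fin (n + 1))) - e))ᗮ
  have hT : T ζ = e := Submodule.reflection_sub (by simp [hζ, e])
  rw [← (measurePreserving_sphereMap T).integral_comp'
    (fun α => φ ((α : EuclideanSpace ℝ (Fin (n + 1))) 0))]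
  congr 1
  ext α
  rw [coe_sphereMap, sphereDot, ← T.inner_map_map, hT, real_inner_comm]
  simp [e, EuclideanSpace.inner_single_left]

/-! ### Integrals over caps solve the zonal equation -/

/-- Differentiation under the integral sign over a compact space. -/
lemma hasDerivAt_integral_of_continuous {X : Type*} [TopologicalSpace X] [CompactSpace X]
    [MeasurableSpace X] [BorelSpace X] (μ : Measure X) [IsFiniteMeasure μ] {F F' : ℝ → X → ℝ}
    (hF : Continuous (Function.uncurry F)) (hF' : Continuous (Function.uncurry F'))
    (hd : ∀ u x, HasDerivAt (fun u => F u x) (F' u x) u) (u : ℝ) :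
    HasDerivAt (fun u => ∫ x, F u x ∂μ) (∫ x, F' u x ∂μ) u := by
  have hFu : ∀ u, Continuous (F u) := fun u => hF.comp (by fun_prop : Continuous fun x => (u, x))
  have hFu' : ∀ u, Continuous (F' u) := fun u => hF'.comp (by fun_prop : Continuous fun x => (u, x))
  have hm : ∀ {g : X → ℝ}, Continuous g → AEStronglyMeasurable g μ := fun hg =>
    hg.aestronglyMeasurable_of_compactSpace
  obtain ⟨M, hM⟩ := ((isCompact_closedBall u 1).prod isCompact_univ).exists_bound_of_continuousOn
    hF'.continuousOn
  refine (hasDerivAt_integral_of_dominated_loc_of_deriv_le (bound := fun _ => M)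
    (Metric.ball_mem_nhds u one_pos) (Filter.Eventually.of_forall fun v => hm (hFu v))
    ?_ (hm (hFu' u)) ?_ (integrable_const M) ?_).2
  · exact (hFu u).integrable_of_hasCompactSupport (HasCompactSupport.of_compactSpace _)
  · exact Filter.Eventually.of_forall fun x v hv =>
      hM (v, x) ⟨Metric.ball_subset_closedBall hv, trivial⟩
  · exact Filter.Eventually.of_forall fun x v _ => hd v x

/-- The first two derivatives of `u ↦ ∫ P(Z + cos u · X + sin u · Y)`. -/
lemma hasDerivAt_integral_polynomial {S : Type*} [TopologicalSpace S] [CompactSpace S]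
    [MeasurableSpace S] [BorelSpace S] (μ : Measure S) [IsFiniteMeasure μ] (P : Polynomial ℝ)
    {X Y Z : S → ℝ} (hX : Continuous X) (hY : Continuous Y) (hZ : Continuous Z) (u : ℝ) :
    HasDerivAt (fun u => ∫ x, P.eval (Z x + Real.cos u * X x + Real.sin u * Y x) ∂μ)
      (∫ x, P.derivative.eval (Z x + Real.cos u * X x + Real.sin u * Y x) *
        (-Real.sin u * X x + Real.cos u * Y x) ∂μ) u ∧
    HasDerivAt (fun u => ∫ x, P.derivative.eval (Z x + Real.cos u * X x + Real.sin u * Y x) *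
        (-Real.sin u * X x + Real.cos u * Y x) ∂μ)
      (∫ x, (P.derivative.derivative.eval (Z x + Real.cos u * X x + Real.sin u * Y x) *
        (-Real.sin u * X x + Real.cos u * Y x) ^ 2
        - P.derivative.eval (Z x + Real.cos u * X x + Real.sin u * Y x) *
          (Real.cos u * X x + Real.sin u * Y x)) ∂μ) u := by
  have hd1 : ∀ u x, HasDerivAt (fun u => Z x + Real.cos u * X x + Real.sin u * Y x)
      (-Real.sin u * X x + Real.cos u * Y x) u := fun u x => by
    exact (((Real.hasDerivAt_cos u).mul_const (X x)).const_add (Z x)).add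
      ((Real.hasDerivAt_sin u).mul_const (Y x))
  have hd2 : ∀ u x, HasDerivAt (fun u => -Real.sin u * X x + Real.cos u * Y x)
      (-(Real.cos u * X x + Real.sin u * Y x)) u := fun u x => by
    convert! ((Real.hasDerivAt_sin u).neg.mul_const (X x)).add
      ((Real.hasDerivAt_cos u).mul_const (Y x)) using 1
    ring
  constructor
  · refine hasDerivAt_integral_of_continuous μ
      (F := fun u x => P.eval (Z x + Real.cos u * X x + Real.sin u * Y x))
      (F' := fun u x => P.derivative.eval (Z x + Real.cos u * X x + Real.sin u * Y x) *
        (-Real.sin u * X x + Real.cos u * Y x)) ?_ ?_ (fun u x => ?_) u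
    · unfold Function.uncurry; fun_prop
    · unfold Function.uncurry; fun_prop
    · exact (P.hasDerivAt _).comp u (hd1 u x)
  · refine hasDerivAt_integral_of_continuous μ
      (F := fun u x => P.derivative.eval (Z x + Real.cos u * X x + Real.sin u * Y x) *
        (-Real.sin u * X x + Real.cos u * Y x))
      (F' := fun u x => P.derivative.derivative.eval (Z x + Real.cos u * X x + Real.sin u * Y x) *
        (-Real.sin u * X x + Real.cos u * Y x) ^ 2
        - P.derivative.eval (Z x + Real.cos u * X x + Real.sin u * Y x) *
          (Real.cos u * X x + Real.sin u * Y x)) ?_ ?_ (fun u x => ?_) u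
    · unfold Function.uncurry; fun_prop
    · unfold Function.uncurry; fun_prop
    · convert! ((P.derivative.hasDerivAt _).comp u (hd1 u x)).mul (hd2 u x) using 1
      simp only [Function.comp]
      ring

instance {n : ℕ} : IsFiniteMeasure (surfaceMeasure n) := by
  unfold surfaceMeasure
  infer_instance

lemma sphereDot_comm {n : ℕ} (α β : UnitSphere n) : sphereDot α β = sphereDot β α :=
  real_inner_comm _ _

@[fun_prop]
lemma continuous_sphereDot_left {n : ℕ} (β : UnitSphere n) :
    Continuous fun α => sphereDot α β := by
  unfold sphereDot
  fun_prop

lemma sphereDot_self {n : ℕ} (α : UnitSphere n) : sphereDot α α = 1 := by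
  simp [sphereDot]

lemma abs_sphereDot_le {n : ℕ} (α β : UnitSphere n) : |sphereDot α β| ≤ 1 := by
  simpa [sphereDot] using abs_real_inner_le_norm (α : EuclideanSpace ℝ (Fin n)) β

lemma measurableSet_sphericalCap {n : ℕ} (ζ : UnitSphere n) (h : ℝ) :
    MeasurableSet (sphericalCap ζ h) :=
  measurableSet_le measurable_const (continuous_sphereDot_left ζ).measurable

/-- The integral of `P(α · β)` over `α` in a cap, as a function of `β`. -/
noncomputable def capIntegral {n : ℕ} (P : Polynomial ℝ) (ζ : UnitSphere n) (h : ℝ)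
    (β : UnitSphere n) : ℝ :=
  ∫ α in sphericalCap ζ h, P.eval (sphereDot α β) ∂surfaceMeasure n

/-- The integral of `P(α · β)` over `α` in a cap depends only on the height of `β`. -/
lemma capIntegral_congr {n : ℕ} (P : Polynomial ℝ) {ζ : UnitSphere n} (h : ℝ)
    {β β' : UnitSphere n} (hβ : sphereDot β ζ = sphereDot β' ζ) :
    capIntegral P ζ h β = capIntegral P ζ h β' := by
  -- The reflection that exchanges `β` and `β'` fixes the centre of the cap.
  let T := Submodule.reflection (ℝ ∙ ((β : EuclideanSpace ℝ (Fin n)) - β'))ᗮ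
  have h1 : sphereMap T β = β' := Subtype.ext (Submodule.reflection_sub (by simp))
  have h2 : sphereMap T ζ = ζ := by
    refine Subtype.ext (Submodule.reflection_mem_subspace_eq_self ?_)
    rw [Submodule.mem_orthogonal_singleton_iff_inner_right, inner_sub_left, sub_eq_zero]
    exact hβ
  have h3 : sphereMap T ⁻¹' sphericalCap ζ h = sphericalCap ζ h := by
    ext α
    simp only [sphericalCap, Set.mem_preimage, Set.mem_ofPred_eq]
    nth_rewrite 1 [← h2]
    rw [sphereDot_sphereMap]
  unfold capIntegral
  rw [← (measurePreserving_sphereMap T).setIntegral_preimage_emb (sphereMap T).measurableEmbedding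
    (fun α => P.eval (sphereDot α β')), h3]
  simp only [← h1, sphereDot_sphereMap]

lemma exists_orthonormalBasis_zero {n : ℕ} (ζ : UnitSphere (n + 1)) :
    ∃ b : OrthonormalBasis (Fin (n + 1)) ℝ (EuclideanSpace ℝ (Fin (n + 1))), b 0 = ζ := by
  obtain ⟨b, hb⟩ := Orthonormal.exists_orthonormalBasis_extension_of_card_eq (𝕜 := ℝ)
    (E := EuclideanSpace ℝ (Fin (n + 1))) (ι := Fin (n + 1)) (by simp)
    (v := fun _ => ζ) (s := {0}) (by
      refine ⟨fun i => by simp, fun i j hij => ?_⟩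
      exact absurd (Subsingleton.elim i j) hij)
  exact ⟨b, hb 0 rfl⟩

/-- The integral of `P(α · β)` at a point `β = p b_i + q b_j + r b_l` does not change when `(q, r)`
rotates, as it depends only on `β · b_i`. -/
lemma capIntegral_eq_integral_basis {n : ℕ} (P : Polynomial ℝ) {ζ : UnitSphere n} (h : ℝ)
    (b : OrthonormalBasis (Fin n) ℝ (EuclideanSpace ℝ (Fin n))) {i j l : Fin n} (hb : b i = ζ)
    (hij : i ≠ j) (hil : i ≠ l) (hjl : j ≠ l) {p q r : ℝ} (hpqr : p ^ 2 + q ^ 2 + r ^ 2 = 1)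
    {β : UnitSphere n} (hβ : sphereDot β ζ = p) :
    ∫ α in sphericalCap ζ h, P.eval (p * inner ℝ (α : EuclideanSpace ℝ (Fin n)) (b i)
      + q * inner ℝ (α : EuclideanSpace ℝ (Fin n)) (b j)
      + r * inner ℝ (α : EuclideanSpace ℝ (Fin n)) (b l)) ∂surfaceMeasure n
      = capIntegral P ζ h β := by
  have hin : inner ℝ (p • b i + q • b j + r • b l) (p • b i + q • b j + r • b l) = 1 := by
    simp only [inner_add_left, inner_add_right, real_inner_smul_left, real_inner_smul_right,
      b.inner_eq_ite]
    simp [hij, hil, hjl, hij.symm, hil.symm, hjl.symm]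
    linarith
  have hnorm : ‖p • b i + q • b j + r • b l‖ = 1 := by
    rw [real_inner_self_eq_norm_sq] at hin
    exact (pow_eq_one_iff_of_nonneg (norm_nonneg _) two_ne_zero).1 hin
  rw [capIntegral_congr P h (β' := ⟨p • b i + q • b j + r • b l, by simpa using hnorm⟩)]
  · simp only [capIntegral, sphereDot, inner_add_right, real_inner_smul_right]
  · rw [hβ, sphereDot]
    simp only [← hb, inner_add_left, real_inner_smul_left, b.inner_eq_ite]
    simp [hij.symm, hil.symm]

lemma exists_sphereDot_eq {n : ℕ} (ζ : UnitSphere (n + 2)) {p q : ℝ} (hpq : p ^ 2 + q ^ 2 = 1) :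
    ∃ β : UnitSphere (n + 2), sphereDot β ζ = p := by
  obtain ⟨b, hb⟩ := exists_orthonormalBasis_zero ζ
  have hin : inner ℝ (p • b 0 + q • b 1) (p • b 0 + q • b 1) = 1 := by
    simp only [inner_add_left, inner_add_right, real_inner_smul_left, real_inner_smul_right,
      b.inner_eq_ite]
    simp
    linarith
  refine ⟨⟨p • b 0 + q • b 1, ?_⟩, ?_⟩
  · rw [real_inner_self_eq_norm_sq] at hin
    simpa using (pow_eq_one_iff_of_nonneg (norm_nonneg _) two_ne_zero).1 hin
  · rw [sphereDot]
    simp only [← hb, inner_add_left, real_inner_smul_left, b.inner_eq_ite]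
    simp

/-- As a function of the polar angle of `β`, the integral of `P(α · β)` over `α` in a cap solves the
same zonal equation as `P(cos θ)`. -/
lemma exists_isZonalSolution_capIntegral {N : ℕ} (hN : N ≠ 0) {lam : ℝ} {P : Polynomial ℝ}
    (hP : ∀ x, (1 - x ^ 2) * P.derivative.derivative.eval x
      - (N + 1) * x * P.derivative.eval x + lam * P.eval x = 0)
    (ζ : UnitSphere (N + 2)) (h : ℝ) :
    ∃ G₀ G₁ G₂ : ℝ → ℝ, IsZonalSolution N lam G₀ G₁ G₂ ∧
      ∀ θ β, sphereDot β ζ = Real.cos θ → G₀ θ = capIntegral P ζ h β := by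
  obtain ⟨b, hb⟩ := exists_orthonormalBasis_zero ζ
  set μ := (surfaceMeasure (N + 2)).restrict (sphericalCap ζ h) with hμ
  let a : Fin (N + 2) → UnitSphere (N + 2) → ℝ :=
    fun i α => inner ℝ (α : EuclideanSpace ℝ (Fin (N + 2))) (b i)
  have ha : ∀ i, Continuous (a i) := fun i => by
    simp only [a]
    fun_prop
  have hpars : ∀ α, a 0 α ^ 2 + (a 1 α ^ 2 + ∑ i : Fin N, a i.succ.succ α ^ 2) = 1 := by
    intro α
    have := b.sum_sq_inner_right (α : EuclideanSpace ℝ (Fin (N + 2)))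
    rw [Fin.sum_univ_succ, Fin.sum_univ_succ] at this
    simp only [a, real_inner_comm (b _)]
    simpa using this
  have hI : ∀ {g : UnitSphere (N + 2) → ℝ}, Continuous g → Integrable g μ := fun hg =>
    hg.integrable_of_hasCompactSupport (HasCompactSupport.of_compactSpace _)
  have hmain := hasDerivAt_integral_polynomial μ P (ha 0) (ha 1) (Z := fun _ => 0) continuous_const
  simp only [zero_add] at hmain
  refine ⟨_, _, _, ⟨fun θ => (hmain θ).1, fun θ => (hmain θ).2, fun θ hθ => ?_⟩, fun θ β hβ => ?_⟩
  · have hs := (Real.sin_pos_of_pos_of_lt_pi hθ.1 hθ.2).ne'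
    have hsc := Real.sin_sq_add_cos_sq θ
    obtain ⟨β, hβ⟩ := exists_sphereDot_eq ζ (by linarith : Real.cos θ ^ 2 + Real.sin θ ^ 2 = 1)
    set s := Real.sin θ
    set c := Real.cos θ
    -- Rotating `β` about `ζ` does not change the integral, so the second derivative in each of the
    -- directions orthogonal to both `ζ` and the meridian is zero.
    have hrot : ∀ i : Fin N, ∫ α, (P.derivative.derivative.eval (c * a 0 α + s * a 1 α) *
        (s * a i.succ.succ α) ^ 2 - P.derivative.eval (c * a 0 α + s * a 1 α) * (s * a 1 α)) ∂μ
        = 0 := by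
      intro i
      have hr := hasDerivAt_integral_polynomial μ P (Z := fun α => c * a 0 α)
        (X := fun α => s * a 1 α) (Y := fun α => s * a i.succ.succ α)
        ((ha 1).const_mul s) ((ha _).const_mul s) ((ha 0).const_mul c)
      have hconst : ∀ u, ∫ α, P.eval (c * a 0 α + Real.cos u * (s * a 1 α)
          + Real.sin u * (s * a i.succ.succ α)) ∂μ = capIntegral P ζ h β := by
        intro u
        rw [← capIntegral_eq_integral_basis P h b hb (j := 1) (l := i.succ.succ) (by simp)
          (Fin.succ_ne_zero _).symm (by simp [Fin.ext_iff])
          (p := c) (q := Real.cos u * s) (r := Real.sin u * s)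
          (by linear_combination hsc + s ^ 2 * Real.sin_sq_add_cos_sq u) hβ]
        simp only [a, hμ, mul_assoc]
      have h1 : ∀ u, ∫ α, P.derivative.eval (c * a 0 α + Real.cos u * (s * a 1 α)
          + Real.sin u * (s * a i.succ.succ α)) * (-Real.sin u * (s * a 1 α)
          + Real.cos u * (s * a i.succ.succ α)) ∂μ = 0 := by
        intro u
        have := (hr u).1
        simp only [hconst] at this
        exact this.unique (hasDerivAt_const u _)
      have h2 := (hr 0).2
      simp only [h1] at h2
      have h3 := h2.unique (hasDerivAt_const (0 : ℝ) (0 : ℝ))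
      simpa using h3
    have hB : ∀ i : Fin N, s * ∫ α, P.derivative.derivative.eval (c * a 0 α + s * a 1 α) *
        a i.succ.succ α ^ 2 ∂μ = ∫ α, P.derivative.eval (c * a 0 α + s * a 1 α) * a 1 α ∂μ := by
      intro i
      apply mul_left_cancel₀ hs
      have h1 := hrot i
      rw [integral_sub (hI (by fun_prop)) (hI (by fun_prop)), sub_eq_zero] at h1
      rw [← mul_assoc, ← integral_const_mul, ← integral_const_mul]
      refine Eq.trans (integral_congr_ae (.of_forall fun α => ?_))
        (h1.trans (integral_congr_ae (.of_forall fun α => ?_)))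
      · ring
      · ring
    have hD : ∫ α, P.derivative.eval (c * a 0 α + s * a 1 α) * a 1 α ∂μ
        = s * (∫ α, P.derivative.eval (c * a 0 α + s * a 1 α) * (c * a 0 α + s * a 1 α) ∂μ)
          + c * ∫ α, P.derivative.eval (c * a 0 α + s * a 1 α) * (-s * a 0 α + c * a 1 α) ∂μ := by
      rw [← integral_const_mul, ← integral_const_mul,
        ← integral_add (hI (by fun_prop)) (hI (by fun_prop))]
      congr 1
      ext α
      linear_combination
        (-(P.derivative.eval (c * a 0 α + s * a 1 α) * a 1 α)) * hsc
    -- The Laplacian on the sphere: the frame consists of the meridian direction and the directions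
    -- `b i.succ.succ`.
    have hlap : (∫ α, P.derivative.derivative.eval (c * a 0 α + s * a 1 α) *
          (-s * a 0 α + c * a 1 α) ^ 2 ∂μ)
        + ∑ i : Fin N, ∫ α, P.derivative.derivative.eval (c * a 0 α + s * a 1 α) *
          a i.succ.succ α ^ 2 ∂μ
        = (N + 1) * (∫ α, P.derivative.eval (c * a 0 α + s * a 1 α) *
            (c * a 0 α + s * a 1 α) ∂μ)
          - lam * ∫ α, P.eval (c * a 0 α + s * a 1 α) ∂μ := by
      rw [← integral_const_mul, ← integral_const_mul,
        ← integral_finsetSum _ (fun i _ => hI (by fun_prop)),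
        ← integral_add (hI (by fun_prop)) (hI (by fun_prop)),
        ← integral_sub (hI (by fun_prop)) (hI (by fun_prop))]
      congr 1
      ext α
      rw [← Finset.mul_sum]
      linear_combination hP (c * a 0 α + s * a 1 α)
        + P.derivative.derivative.eval (c * a 0 α + s * a 1 α) * hpars α
        + P.derivative.derivative.eval (c * a 0 α + s * a 1 α) * (a 0 α ^ 2 + a 1 α ^ 2) * hsc
    rw [integral_sub (hI (by fun_prop)) (hI (by fun_prop))]
    have hsum : s * ∑ i : Fin N, ∫ α, P.derivative.derivative.eval (c * a 0 α + s * a 1 α) *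
        a i.succ.succ α ^ 2 ∂μ
        = N * ∫ α, P.derivative.eval (c * a 0 α + s * a 1 α) * a 1 α ∂μ := by
      rw [Finset.mul_sum, Finset.sum_congr rfl fun i _ => hB i]
      simp
    rw [hD] at hsum
    linear_combination s * hlap - hsum
  · have hl : (1 : Fin (N + 2)) ≠ Fin.last (N + 1) := by
      rw [Ne, Fin.ext_iff]
      simp
      lia
    rw [← capIntegral_eq_integral_basis P h b hb (j := 1) (l := Fin.last (N + 1)) (by simp)
      (Fin.last_pos).ne hl (p := Real.cos θ) (q := Real.sin θ) (r := 0)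
      (by linear_combination Real.sin_sq_add_cos_sq θ) hβ]
    simp only [zero_mul, add_zero, a, hμ]

/-- The integral of `P(α · β)` over `α` in a cap is a multiple of `P(β · ζ)`, as both functions of
`β` are zonal and solve the same equation. -/
lemma capIntegral_mul_eval_one {N : ℕ} (hN : N ≠ 0) {lam : ℝ} (hlam : 0 < lam) {P : Polynomial ℝ}
    (hP : ∀ x, (1 - x ^ 2) * P.derivative.derivative.eval x
      - (N + 1) * x * P.derivative.eval x + lam * P.eval x = 0)
    {ε : ℝ} (hε : ∀ x, P.eval (-x) = ε * P.eval x) (ζ : UnitSphere (N + 2)) (h : ℝ)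
    (β : UnitSphere (N + 2)) :
    P.eval 1 * capIntegral P ζ h β = capIntegral P ζ h ζ * P.eval (sphereDot β ζ) := by
  obtain ⟨G₀, G₁, G₂, hG, hGβ⟩ := exists_isZonalSolution_capIntegral hN hP ζ h
  have hnorth : ∀ β, 0 ≤ sphereDot β ζ →
      P.eval 1 * capIntegral P ζ h β = capIntegral P ζ h ζ * P.eval (sphereDot β ζ) := by
    intro β hβ
    have hle := abs_le.1 (abs_sphereDot_le β ζ)
    have hcos : Real.cos (Real.arccos (sphereDot β ζ)) = sphereDot β ζ :=
      Real.cos_arccos hle.1 hle.2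
    have hG0 : G₀ 0 = capIntegral P ζ h ζ := hGβ 0 ζ (by rw [sphereDot_self, Real.cos_zero])
    have heven : ∀ θ, G₀ (-θ) = G₀ θ := by
      intro θ
      obtain ⟨γ, hγ⟩ := exists_sphereDot_eq ζ (Real.cos_sq_add_sin_sq θ)
      rw [hGβ θ γ hγ, hGβ (-θ) γ (by rw [hγ, Real.cos_neg])]
    -- `G₀` is even, so its derivative is zero at the pole.
    have hG1 : G₁ 0 = 0 := by
      have h1 : HasDerivAt (fun θ => G₀ (-θ)) (-G₁ 0) 0 := by
        simpa [Function.comp_def] using (hG.hasDerivAt₀ (-0)).comp (0 : ℝ) (hasDerivAt_neg' 0)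
      simp only [heven] at h1
      linarith [h1.unique (hG.hasDerivAt₀ 0)]
    have := (hG.lincomb (isZonalSolution_polynomial hP) (P.eval 1)
      (-capIntegral P ζ h ζ)).eq_zero hlam (by simp [hG0]; ring) (by simp [hG1])
      (θ := Real.arccos (sphereDot β ζ))
      ⟨Real.arccos_nonneg _, Real.arccos_le_pi_div_two.2 hβ⟩
    simp only [hcos] at this
    rw [hGβ _ β hcos.symm] at this
    linarith
  rcases le_total 0 (sphereDot β ζ) with h0 | h0
  · exact hnorth β h0
  · have hneg : sphereDot (-β) ζ = -sphereDot β ζ := inner_neg_left _ _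
    have h1 := hnorth (-β) (by rw [hneg]; linarith)
    have h2 : capIntegral P ζ h (-β) = ε * capIntegral P ζ h β := by
      rw [capIntegral, capIntegral, ← integral_const_mul]
      congr 1
      ext α
      rw [← hε]
      congr 1
      exact inner_neg_right _ _
    have h3 : P.eval (sphereDot β ζ) = ε * P.eval (-sphereDot β ζ) := by
      rw [← hε, neg_neg]
    have h4 : capIntegral P ζ h β = ε * capIntegral P ζ h (-β) := by
      rw [capIntegral, capIntegral, ← integral_const_mul]
      congr 1
      ext α
      rw [← hε]
      congr 1
      rw [sphereDot, sphereDot, ← inner_neg_right]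
      simp
    rw [hneg] at h1
    rw [h4, h3]
    linear_combination ε * h1

/-- At the centre of the cap, the equation turns the integral into the flux `sin^N T · G'(T)`
through the boundary of the cap, which the weighted energy bounds uniformly in the height of the cap. -/
lemma exists_capIntegral_center_sq_le {N : ℕ} (hN : N ≠ 0) : ∃ c : ℝ, ∀ (lam : ℝ), 0 < lam →
    ∀ P : Polynomial ℝ, (∀ x, (1 - x ^ 2) * P.derivative.derivative.eval x
      - (N + 1) * x * P.derivative.eval x + lam * P.eval x = 0) →
    ∀ (ζ : UnitSphere (N + 2)) (h : ℝ), (lam * capIntegral P ζ h ζ) ^ 2 ≤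
      c ^ 2 * (P.derivative.eval 0 ^ 2 + lam * P.eval 0 ^ 2) := by
  obtain ⟨c, hc⟩ := integral_sphere_zonal (n := N + 1) (by lia)
  refine ⟨c, fun lam hlam P hP ζ h => ?_⟩
  have hG := isZonalSolution_polynomial hP
  set T := Real.arccos h
  have hT : T ∈ Set.Icc 0 Real.pi := ⟨Real.arccos_nonneg _, Real.arccos_le_pi _⟩
  have hcap : capIntegral P ζ h ζ
      = c * ∫ θ in (0)..T, P.eval (Real.cos θ) * Real.sin θ ^ N := by
    -- The cutoff to `[-1, 1]` makes `φ` bounded.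
    set φ : ℝ → ℝ := (Set.Icc (-1) 1 ∩ Set.Ici h).indicator fun t => P.eval t with hφ
    have h1 : ∀ α : UnitSphere (N + 2), (sphericalCap ζ h).indicator
        (fun α => P.eval (sphereDot α ζ)) α = φ (sphereDot α ζ) := by
      intro α
      have := abs_le.1 (abs_sphereDot_le α ζ)
      simp [hφ, Set.indicator_apply, sphericalCap, this.1, this.2]
    have hb : ∃ M, ∀ t, |φ t| ≤ M := by
      obtain ⟨M, hM⟩ := (isCompact_Icc (a := (-1 : ℝ)) (b := 1)).exists_bound_of_continuousOn
        P.continuous.continuousOn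
      have hM0 : 0 ≤ M := (norm_nonneg _).trans (hM 0 (by simp))
      refine ⟨M, fun t => ?_⟩
      by_cases ht : t ∈ Set.Icc (-1) 1 ∩ Set.Ici h
      · rw [hφ, Set.indicator_of_mem ht]
        exact hM t ht.1
      · rw [hφ, Set.indicator_of_notMem ht, abs_zero]
        exact hM0
    rw [capIntegral, ← integral_indicator (measurableSet_sphericalCap ζ h)]
    simp_rw [h1]
    rw [hc ζ φ (P.continuous.measurable.indicator
      (measurableSet_Icc.inter measurableSet_Ici)) hb, Nat.add_sub_cancel,
      intervalIntegral.integral_of_le Real.pi_pos.le, intervalIntegral.integral_of_le hT.1]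
    congr 1
    have h2 : ∀ θ ∈ Set.Ioc 0 Real.pi, φ (Real.cos θ) * Real.sin θ ^ N
        = (Set.Iic T).indicator (fun θ => P.eval (Real.cos θ) * Real.sin θ ^ N) θ := by
      intro θ hθ
      have hiff : h ≤ Real.cos θ ↔ θ ≤ T := by
        constructor
        · intro hle
          rw [← Real.arccos_cos hθ.1.le hθ.2]
          exact Real.arccos_le_arccos hle
        · intro hle
          have hh : h ≤ 1 := by
            by_contra hlt
            push Not at hlt
            have : T = 0 := Real.arccos_of_one_le hlt.le
            linarith [hθ.1]
          rcases le_total (-1) h with h' | h'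
          · rw [← Real.cos_arccos h' hh]
            exact Real.cos_le_cos_of_nonneg_of_le_pi hθ.1.le hT.2 hle
          · exact h'.trans (Real.neg_one_le_cos θ)
      simp [hφ, Set.indicator_apply, Real.neg_one_le_cos, Real.cos_le_one, hiff]
    rw [setIntegral_congr_fun measurableSet_Ioc h2, setIntegral_indicator measurableSet_Iic,
      Set.Ioc_inter_Iic, min_eq_right hT.2]
  have h1 := hG.integral_mul_sin_pow hN hT
  have h2 := hG.weightedEnergy_le hN hlam.le hT
  simp only [Real.cos_pi_div_two, Real.sin_pi_div_two, one_mul, neg_sq] at h2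
  have h3 : lam * capIntegral P ζ h ζ
      = c * (Real.sin T ^ N * (Real.sin T * P.derivative.eval (Real.cos T))) := by
    rw [hcap]
    linear_combination c * h1
  rw [h3, mul_pow, mul_pow, ← pow_mul, mul_comm N 2]
  refine mul_le_mul_of_nonneg_left (le_trans ?_ h2) (sq_nonneg c)
  refine mul_le_mul_of_nonneg_left ?_ (by rw [pow_mul]; positivity)
  have : 0 ≤ lam * P.eval (Real.cos T) ^ 2 := by positivity
  linarith

/-! ### The estimate for two concentric caps -/

theorem proposition7p1 (n : ℕ) (hn : 3 ≤ n) :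
    ∃ C : ℝ, 0 < C ∧ ∀ k : ℕ, 1 ≤ k → ∀ (ζ : UnitSphere n) (h₁ h₂ : ℝ),
      |∫ α in sphericalCap ζ h₁, ∫ β in sphericalCap ζ h₂,
          (gegenbauer ((n : ℝ) / 2 - 1) k).eval (sphereDot α β)
            ∂(surfaceMeasure n) ∂(surfaceMeasure n)|
        ≤ C * (k : ℝ) ^ ((n : ℝ) / 2 - 3) := by
  obtain ⟨N, rfl⟩ : ∃ N, n = N + 2 := ⟨n - 2, by lia⟩
  have hN : N ≠ 0 := by lia
  obtain ⟨c, hc⟩ := exists_capIntegral_center_sq_le hN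
  have hN0 : (0 : ℝ) < N := by exact_mod_cast Nat.pos_of_ne_zero hN
  obtain ⟨ν, hν⟩ : ∃ ν : ℝ, ν = N / 2 := ⟨_, rfl⟩
  have hν0 : 0 < ν := by rw [hν]; positivity
  rw [show (((N + 2 : ℕ) : ℝ) / 2 - 1) = ν by push_cast; rw [hν]; ring,
    show (((N + 2 : ℕ) : ℝ) / 2 - 3) = ν - 2 by push_cast; rw [hν]; ring]
  refine ⟨(c ^ 2 + 1) * (2 * (ν + 1)), by positivity, fun k hk ζ h₁ h₂ => ?_⟩
  have hk' : (1 : ℝ) ≤ k := by exact_mod_cast hk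
  set P := gegenbauer ν k with hPdef
  set lam : ℝ := k * (k + 2 * ν) with hlamdef
  have hlam : 0 < lam := by positivity
  have hP : ∀ x, (1 - x ^ 2) * P.derivative.derivative.eval x
      - (N + 1) * x * P.derivative.eval x + lam * P.eval x = 0 := by
    intro x
    have := gegenbauer_ode ν k x
    rw [show 2 * ν + 1 = (N : ℝ) + 1 by rw [hν]; ring] at this
    exact this
  set F := equatorEnergy ν k with hF
  have hFpos : 0 < F := equatorEnergy_pos hν0 hk
  have hFle : F ≤ lam * (2 * (ν + 1) * (k : ℝ) ^ ν) ^ 2 := equatorEnergy_le hν0 hk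
  -- The energy at the pole `θ = 0` dominates the energy on the equator.
  have hFP : F ≤ lam * P.eval 1 ^ 2 := by
    have h := (isZonalSolution_polynomial hP).energy_antitoneOn
      ⟨le_rfl, by positivity⟩ ⟨by positivity, le_rfl⟩ (by positivity : (0 : ℝ) ≤ Real.pi / 2)
    simpa [hF, equatorEnergy] using h
  set D := ∫ α in sphericalCap ζ h₁, ∫ β in sphericalCap ζ h₂, P.eval (sphereDot α β)
    ∂(surfaceMeasure (N + 2)) ∂(surfaceMeasure (N + 2)) with hD
  have hprod : P.eval 1 * D = capIntegral P ζ h₂ ζ * capIntegral P ζ h₁ ζ := by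
    rw [hD, ← integral_const_mul]
    conv_rhs => rw [capIntegral.eq_def P ζ h₁]
    rw [← integral_const_mul]
    congr 1
    ext α
    simp only [sphereDot_comm α]
    rw [sphereDot_comm ζ α]
    exact capIntegral_mul_eval_one hN hlam hP (gegenbauer_eval_neg ν k) ζ h₂ α
  have h1 := hc lam hlam P hP ζ h₁
  have h2 := hc lam hlam P hP ζ h₂
  change _ ≤ c ^ 2 * F at h1 h2
  -- `lam⁴ P(1)² D² ≤ c⁴ F²`, and `F ≤ lam P(1)²` cancels one factor `F`.
  have h3 : lam ^ 4 * (P.eval 1 ^ 2 * D ^ 2) ≤ c ^ 4 * F ^ 2 := by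
    have := mul_le_mul h1 h2 (sq_nonneg _) (by positivity)
    calc lam ^ 4 * (P.eval 1 ^ 2 * D ^ 2) = lam ^ 4 * (P.eval 1 * D) ^ 2 := by ring
      _ = (lam * capIntegral P ζ h₁ ζ) ^ 2 * (lam * capIntegral P ζ h₂ ζ) ^ 2 := by
          rw [hprod]; ring
      _ ≤ _ := this
      _ = _ := by ring
  have h4 : lam ^ 3 * D ^ 2 ≤ c ^ 4 * F := by
    refine le_of_mul_le_mul_left ?_ hFpos
    calc F * (lam ^ 3 * D ^ 2) ≤ (lam * P.eval 1 ^ 2) * (lam ^ 3 * D ^ 2) :=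
          mul_le_mul_of_nonneg_right hFP (by positivity)
      _ = lam ^ 4 * (P.eval 1 ^ 2 * D ^ 2) := by ring
      _ ≤ c ^ 4 * F ^ 2 := h3
      _ = F * (c ^ 4 * F) := by ring
  have h5 : (lam * D) ^ 2 ≤ (c ^ 2 * (2 * (ν + 1) * (k : ℝ) ^ ν)) ^ 2 := by
    refine le_of_mul_le_mul_left ?_ hlam
    calc lam * (lam * D) ^ 2 = lam ^ 3 * D ^ 2 := by ring
      _ ≤ c ^ 4 * F := h4
      _ ≤ c ^ 4 * (lam * (2 * (ν + 1) * (k : ℝ) ^ ν) ^ 2) := by gcongr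
      _ = _ := by ring
  have h6 : lam * |D| ≤ c ^ 2 * (2 * (ν + 1) * (k : ℝ) ^ ν) := by
    rw [← abs_of_pos hlam, ← abs_mul]
    exact abs_le_of_sq_le_sq h5 (by positivity)
  rw [Real.rpow_sub (by linarith), Real.rpow_two, mul_div_assoc', le_div_iff₀ (by positivity)]
  have h7 : |D| * (k : ℝ) ^ 2 ≤ lam * |D| := by
    rw [mul_comm]
    refine mul_le_mul_of_nonneg_right ?_ (abs_nonneg _)
    rw [hlamdef]
    nlinarith
  have h8 : 0 ≤ 2 * (ν + 1) * (k : ℝ) ^ ν := by positivity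
  linarith
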